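/- Let $n\ge 0$, let $\delta=(n,n-1,\ldots,1)$ be the staircase partition, and let $\mu\subseteq\delta$ be a partition. For a set $I\subseteq\mathbb N=\{1,2,3,\ldots\}$, a generalized staircase tableau of shape $\delta/\mu$ and set $I$ is a filling of the boxes of the skew Young diagram $\delta/\mu$ with positive integers such that rows and columns are weakly increasing, each $i\in I$ occurs at most once in every row, and each $i\notin I$ occurs at most once in every column. Let $\mathbf G(\delta/\mu,I)$ be the set of all such tableaux, and let the weight $\mathrm{wt}(T)$ of a tableau $T$ be the vector whose $i$-th coordinate, $i\ge 1$, is the number of boxes of $T$ containing $i$. Then for any subsets $I,I'\subseteq\mathbb N$ there is a bijection $\varphi:\mathbf G(\delta/\mu,I)\to\mathbf G(\delta/\mu,I')$ with $\mathrm{wt}(\varphi(T))=\mathrm{wt}(T)$ for every $T\in\mathbf G(\delta/\mu,I)$. -/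

import Mathlib

/-- The staircase partition `δ = (n, n-1, …, 1)`. Cells are `(row, column)`, indexed from `0`,
so row `i` consists of the `n - i` cells `(i, 0), …, (i, n - i - 1)`. -/
def staircase (n : ℕ) : YoungDiagram where
  cells := (Finset.range n ×ˢ Finset.range n).filter fun c => c.1 + c.2 < n
  isLowerSet := by
    intro a b hba ha
    have h1 : b.1 ≤ a.1 := hba.1
    have h2 : b.2 ≤ a.2 := hba.2
    simp only [Finset.coe_filter, Finset.mem_product, Finset.mem_range, Set.mem_ofPred_eq] at ha ⊢
    omega

/-- The boxes of the skew diagram `lam / mu`. -/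
abbrev SkewCell (lam mu : YoungDiagram) : Type :=
  {c : ℕ × ℕ // c ∈ lam.cells \ mu.cells}

/-- A generalized staircase tableau of shape `lam / mu` and set `I`: a filling of the boxes of
`lam / mu` by positive integers with weakly increasing rows and columns, in which each `i ∈ I`
occurs at most once in every row and each `i ∉ I` occurs at most once in every column. -/
@[ext]
structure GST (lam mu : YoungDiagram) (I : Set ℕ+) where
  entry : SkewCell lam mu → ℕ+
  row_weak : ∀ b c : SkewCell lam mu, b.1.1 = c.1.1 → b.1.2 ≤ c.1.2 → entry b ≤ entry c
  col_weak : ∀ b c : SkewCell lam mu, b.1.2 = c.1.2 → b.1.1 ≤ c.1.1 → entry b ≤ entry c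
  row_once : ∀ i ∈ I, ∀ b c : SkewCell lam mu,
    b.1.1 = c.1.1 → entry b = i → entry c = i → b = c
  col_once : ∀ i ∉ I, ∀ b c : SkewCell lam mu,
    b.1.2 = c.1.2 → entry b = i → entry c = i → b = c

/-- The weight of a tableau: the vector whose `i`-th coordinate is the number of `i`s in it. -/
def GST.wt {lam mu : YoungDiagram} {I : Set ℕ+} (T : GST lam mu I) : ℕ+ → ℕ :=
  fun i => (Finset.univ.filter fun b : SkewCell lam mu => T.entry b = i).card

/-! Recording, for each `m`, the diagram formed by `mu` and the entries at most `m` turns a tableau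
into a chain of diagrams from `mu` to the staircase. The boxes containing `i` form a vertical strip
if `i ∈ I` and a horizontal strip otherwise, and the weight lists the strip sizes.

Two facts make the kinds irrelevant. Adjacent strips of prescribed kinds and sizes can be
interchanged bijectively with the outer diagrams fixed (`nonempty_stepComm`): by a Bender–Knuth
reflection for equal kinds, by a count of row sets for different kinds. A strip ending at the
staircase consists of corners, hence is of both kinds at once (`strip_staircase`). So any strip can
be moved to the end of the chain, changed in kind, and moved back
(`nonempty_chain_staircase_append`). This gives bijections between the fibres of the weight, which
are glued together. -/

namespace YoungDiagram

/-! ### Young diagrams through their row lengths -/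

/-- The partition whose rows are those of `f`, cut out of the diagram `γ`. -/
def cut (γ : YoungDiagram) (f : ℕ → ℕ) (hf : Antitone f) : YoungDiagram where
  cells := γ.cells.filter fun c => c.2 < f c.1
  isLowerSet := by
    intro a b hba ha
    simp only [Finset.coe_filter, Set.mem_ofPred_eq, mem_cells] at ha ⊢
    exact ⟨γ.up_left_mem hba.1 hba.2 ha.1, hba.2.trans_lt (ha.2.trans_le (hf hba.1))⟩

theorem rowLen_cut {γ : YoungDiagram} {f : ℕ → ℕ} (hf : Antitone f)
    (h : ∀ i, f i ≤ γ.rowLen i) (i : ℕ) : (γ.cut f hf).rowLen i = f i := by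
  have key : ∀ j, j < (γ.cut f hf).rowLen i ↔ j < f i := by
    intro j
    rw [← mem_iff_lt_rowLen, ← mem_cells]
    simp only [cut, Finset.mem_filter, mem_cells, mem_iff_lt_rowLen]
    exact ⟨fun H => H.2, fun H => ⟨H.trans_le (h i), H⟩⟩
  exact le_antisymm (le_of_forall_lt fun j hj => (key j).1 hj)
    (le_of_forall_lt fun j hj => (key j).2 hj)

theorem le_iff_rowLen_le {α β : YoungDiagram} : α ≤ β ↔ ∀ i, α.rowLen i ≤ β.rowLen i := by
  constructor
  · intro h i
    refine le_of_forall_lt fun j hj => ?_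
    rw [← mem_iff_lt_rowLen] at hj ⊢
    exact h hj
  · rintro h ⟨i, j⟩ hc
    have hc : (i, j) ∈ α := hc
    rw [mem_iff_lt_rowLen] at hc
    exact mem_iff_lt_rowLen.2 (hc.trans_le (h i))

theorem ext_rowLen {α β : YoungDiagram} (h : ∀ i, α.rowLen i = β.rowLen i) : α = β :=
  le_antisymm (le_iff_rowLen_le.2 fun i => (h i).le) (le_iff_rowLen_le.2 fun i => (h i).ge)

theorem rowLen_eq_zero {α : YoungDiagram} {i : ℕ} (h : α.colLen 0 ≤ i) : α.rowLen i = 0 := by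
  by_contra hne
  have : (i, 0) ∈ α := mem_iff_lt_rowLen.2 (Nat.pos_of_ne_zero hne)
  rw [mem_iff_lt_colLen] at this
  omega

theorem card_eq_sum_rowLen (α : YoungDiagram) {N : ℕ} (hN : ∀ i, N ≤ i → α.rowLen i = 0) :
    α.card = ∑ i ∈ Finset.range N, α.rowLen i := by
  have hmaps : ∀ c ∈ α.cells, c.1 ∈ Finset.range N := by
    rintro ⟨i, j⟩ hc
    rw [mem_cells, mem_iff_lt_rowLen] at hc
    rw [Finset.mem_range]
    by_contra hi
    rw [hN i (not_lt.1 hi)] at hc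
    exact absurd hc (Nat.not_lt_zero _)
  rw [YoungDiagram.card, Finset.card_eq_sum_card_fiberwise hmaps]
  exact Finset.sum_congr rfl fun i _ => (rowLen_eq_card α).symm

theorem card_transpose (α : YoungDiagram) : α.transpose.card = α.card := by
  simp [YoungDiagram.card, transpose]

/-! ### Horizontal and vertical strips -/

/-- `Strip true α β` says that `β / α` is a horizontal strip, `Strip false α β` that it is a
vertical strip, both in terms of row lengths. -/
def Strip : Bool → YoungDiagram → YoungDiagram → Prop
  | true, α, β => α ≤ β ∧ ∀ i, β.rowLen (i + 1) ≤ α.rowLen i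
  | false, α, β => α ≤ β ∧ ∀ i, β.rowLen i ≤ α.rowLen i + 1

theorem Strip.le {b : Bool} {α β : YoungDiagram} (h : Strip b α β) : α ≤ β := by
  cases b <;> exact h.1

/-- A horizontal strip has at most one box in every column. -/
theorem strip_true_iff {α β : YoungDiagram} : Strip true α β ↔
    α ≤ β ∧ ∀ i i' j, i < i' → (i, j) ∉ α → (i', j) ∉ β := by
  refine and_congr_right fun _ => ⟨fun h i i' j hi hα hβ => ?_, fun h i => ?_⟩
  · have h1 : (i + 1, j) ∈ β := β.up_left_mem hi le_rfl hβ
    rw [mem_iff_lt_rowLen] at h1 hα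
    have := h i
    omega
  · by_contra hlt
    refine h i (i + 1) (α.rowLen i) (Nat.lt_succ_self i) ?_ ?_ <;> rw [mem_iff_lt_rowLen] <;> omega

/-- A vertical strip has at most one box in every row. -/
theorem strip_false_iff {α β : YoungDiagram} : Strip false α β ↔
    α ≤ β ∧ ∀ i j j', j < j' → (i, j) ∉ α → (i, j') ∉ β := by
  refine and_congr_right fun _ => ⟨fun h i j j' hj hα hβ => ?_, fun h i => ?_⟩
  · rw [mem_iff_lt_rowLen] at hβ hα
    have := h i
    omega
  · by_contra hlt
    refine h i (α.rowLen i) (α.rowLen i + 1) (Nat.lt_succ_self _) ?_ ?_ <;>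
      rw [mem_iff_lt_rowLen] <;> omega

theorem strip_transpose {α β : YoungDiagram} :
    Strip true α.transpose β.transpose ↔ Strip false α β := by
  rw [strip_true_iff, strip_false_iff]
  simp only [mem_transpose, Prod.swap_prod_mk, transpose_le_iff]
  exact and_congr_right fun _ => ⟨fun h i j j' => h j j' i, fun h i i' j => h j i i'⟩

/-- `β / α` is a horizontal (`true`) or vertical (`false`) strip with a given number of boxes. -/
def Step (x : Bool × ℕ) (α β : YoungDiagram) : Prop :=
  Strip x.1 α β ∧ β.card = α.card + x.2

theorem step_transpose {k : ℕ} {α β : YoungDiagram} :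
    Step (true, k) α.transpose β.transpose ↔ Step (false, k) α β := by
  simp only [Step, strip_transpose, card_transpose]

/-! ### Commuting strips of the same kind: the Bender–Knuth reflection -/

section HorizontalHorizontal

variable (α γ : YoungDiagram)

/-- The least length of row `i` of a diagram between `α` and `γ` by horizontal strips. -/
def rowMin (i : ℕ) : ℕ := max (α.rowLen i) (γ.rowLen (i + 1))

/-- The largest length of row `i` of a diagram between `α` and `γ` by horizontal strips. -/
def rowMax : ℕ → ℕ
  | 0 => γ.rowLen 0
  | i + 1 => min (α.rowLen i) (γ.rowLen (i + 1))

/-- The intervals allowed to consecutive rows do not overlap beyond an endpoint, so any choice of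
one length per interval is weakly decreasing. This is why rows can be reflected independently. -/
theorem rowMax_succ_le_rowMin (i : ℕ) : rowMax α γ (i + 1) ≤ rowMin α γ i :=
  (min_le_left _ _).trans (le_max_left _ _)

/-- The interlacing conditions decouple: each row length of the middle diagram ranges over its own
interval, determined by `α` and `γ`. -/
theorem strip_strip_iff {β : YoungDiagram} : Strip true α β ∧ Strip true β γ ↔
    ∀ i, rowMin α γ i ≤ β.rowLen i ∧ β.rowLen i ≤ rowMax α γ i := by
  simp only [Strip, le_iff_rowLen_le, rowMin]
  constructor
  · rintro ⟨⟨h1, h2⟩, h3, h4⟩ i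
    refine ⟨max_le (h1 i) (h4 i), ?_⟩
    cases i with
    | zero => exact h3 0
    | succ i => exact le_min (h2 i) (h3 _)
  · intro h
    refine ⟨⟨fun i => (le_max_left _ _).trans (h i).1, fun i => (h (i + 1)).2.trans (min_le_left _ _)⟩,
      fun i => ?_, fun i => (le_max_right _ _).trans (h i).1⟩
    cases i with
    | zero => exact (h 0).2
    | succ i => exact (h (i + 1)).2.trans (min_le_right _ _)

theorem rowMax_le (i : ℕ) : rowMax α γ i ≤ γ.rowLen i := by
  cases i with
  | zero => exact le_rfl
  | succ i => exact min_le_right _ _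

variable {α γ}

/-- The Bender–Knuth reflection of the middle diagram of two horizontal strips. -/
theorem exists_reflection (β : YoungDiagram) (h : Strip true α β ∧ Strip true β γ) :
    ∃ β' : YoungDiagram, ∀ i, β'.rowLen i + β.rowLen i = rowMin α γ i + rowMax α γ i := by
  rw [strip_strip_iff] at h
  have hanti : Antitone fun i => rowMin α γ i + rowMax α γ i - β.rowLen i := by
    refine antitone_nat_of_succ_le fun i => ?_
    have h1 := h i
    have h2 := h (i + 1)
    have h3 := rowMax_succ_le_rowMin α γ i
    omega
  refine ⟨γ.cut _ hanti, fun i => ?_⟩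
  have h1 := h i
  rw [rowLen_cut]
  · omega
  · intro i
    have h1 := h i
    have h2 := rowMax_le α γ i
    omega

/-- The minimum allowed in row `i` and the maximum allowed in row `i + 1` are the max and the min of
the same two numbers, so the interval endpoints sum to the sizes of `α` and `γ`. Hence reflection
exchanges the two strip sizes. -/
theorem card_add_card_of_reflection {β β' : YoungDiagram} (h : Strip true α β ∧ Strip true β γ)
    (hβ' : ∀ i, β'.rowLen i + β.rowLen i = rowMin α γ i + rowMax α γ i) :
    β'.card + β.card = α.card + γ.card := by
  have hz : ∀ i, γ.colLen 0 ≤ i → γ.rowLen i = 0 := fun i => rowLen_eq_zero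
  have hβ : ∀ i, β.rowLen i ≤ γ.rowLen i := le_iff_rowLen_le.1 h.2.le
  have hα : ∀ i, α.rowLen i ≤ γ.rowLen i := le_iff_rowLen_le.1 (h.1.le.trans h.2.le)
  have hβ'γ : ∀ i, β'.rowLen i ≤ γ.rowLen i := by
    intro i
    have h1 := (strip_strip_iff α γ).1 h i
    have h2 := rowMax_le α γ i
    have h3 := hβ' i
    omega
  have hz' : ∀ {δ : YoungDiagram}, (∀ i, δ.rowLen i ≤ γ.rowLen i) →
      ∀ i, γ.colLen 0 + 1 ≤ i → δ.rowLen i = 0 := by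
    intro δ hδ i hi
    have := hδ i
    have := hz i (by omega)
    omega
  -- The range has one row beyond those of `γ`: the vanishing last terms of `α` and `rowMin` and the
  -- equal first terms of `γ` and `rowMax` are split off, leaving sums matched by `max_add_min`.
  rw [card_eq_sum_rowLen β' (hz' hβ'γ), card_eq_sum_rowLen β (hz' hβ),
    card_eq_sum_rowLen α (hz' hα), card_eq_sum_rowLen γ (hz' fun _ => le_rfl),
    ← Finset.sum_add_distrib, Finset.sum_congr rfl fun i _ => hβ' i, Finset.sum_add_distrib,
    Finset.sum_range_succ, Finset.sum_range_succ' (rowMax α γ),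
    Finset.sum_range_succ α.rowLen, Finset.sum_range_succ' γ.rowLen]
  have h1 : rowMin α γ (γ.colLen 0) = 0 := by
    have := hα (γ.colLen 0)
    have := hz (γ.colLen 0) le_rfl
    have := hz (γ.colLen 0 + 1) (by omega)
    simp only [rowMin]
    omega
  have h2 : α.rowLen (γ.colLen 0) = 0 := by
    have := hα (γ.colLen 0)
    have := hz (γ.colLen 0) le_rfl
    omega
  have h3 : ∑ i ∈ Finset.range (γ.colLen 0), rowMin α γ i +
      ∑ i ∈ Finset.range (γ.colLen 0), rowMax α γ (i + 1) =
      ∑ i ∈ Finset.range (γ.colLen 0), α.rowLen i +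
      ∑ i ∈ Finset.range (γ.colLen 0), γ.rowLen (i + 1) := by
    rw [← Finset.sum_add_distrib, ← Finset.sum_add_distrib]
    exact Finset.sum_congr rfl fun i _ => max_add_min _ _
  have h4 : rowMax α γ 0 = γ.rowLen 0 := rfl
  omega

/-- The Bender–Knuth reflection as a map. -/
noncomputable def reflect (β : {β // Strip true α β ∧ Strip true β γ}) : YoungDiagram :=
  (exists_reflection β.1 β.2).choose

theorem rowLen_reflect (β : {β // Strip true α β ∧ Strip true β γ}) (i : ℕ) :
    (reflect β).rowLen i + β.1.rowLen i = rowMin α γ i + rowMax α γ i :=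
  (exists_reflection β.1 β.2).choose_spec i

theorem reflect_mem (β : {β // Strip true α β ∧ Strip true β γ}) :
    Strip true α (reflect β) ∧ Strip true (reflect β) γ := by
  rw [strip_strip_iff]
  intro i
  have h1 := rowLen_reflect β i
  have h2 := (strip_strip_iff α γ).1 β.2 i
  omega

theorem reflect_reflect (β : {β // Strip true α β ∧ Strip true β γ}) :
    reflect ⟨reflect β, reflect_mem β⟩ = β.1 := by
  refine ext_rowLen fun i => ?_
  have h1 := rowLen_reflect β i
  have h2 := rowLen_reflect ⟨reflect β, reflect_mem β⟩ i
  dsimp only at h2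
  omega

theorem step_reflect {k l : ℕ} {β : YoungDiagram}
    (h : Step (true, k) α β ∧ Step (true, l) β γ) :
    Step (true, l) α (reflect ⟨β, h.1.1, h.2.1⟩) ∧
      Step (true, k) (reflect ⟨β, h.1.1, h.2.1⟩) γ := by
  have h1 := reflect_mem ⟨β, h.1.1, h.2.1⟩
  have h2 := card_add_card_of_reflection ⟨h.1.1, h.2.1⟩ (rowLen_reflect ⟨β, h.1.1, h.2.1⟩)
  have h3 := h.1.2
  have h4 := h.2.2
  dsimp only at h3 h4
  exact ⟨⟨h1.1, by dsimp only; omega⟩, ⟨h1.2, by dsimp only; omega⟩⟩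

/-- Horizontal strips commute. -/
noncomputable def horizontalComm (k l : ℕ) (α γ : YoungDiagram) :
    {β // Step (true, k) α β ∧ Step (true, l) β γ} ≃
      {β // Step (true, l) α β ∧ Step (true, k) β γ} where
  toFun β := ⟨_, step_reflect β.2⟩
  invFun β := ⟨_, step_reflect β.2⟩
  left_inv β := Subtype.ext (reflect_reflect ⟨β.1, β.2.1.1, β.2.2.1⟩)
  right_inv β := Subtype.ext (reflect_reflect ⟨β.1, β.2.1.1, β.2.2.1⟩)

/-- Vertical strips commute. -/
noncomputable def verticalComm (k l : ℕ) (α γ : YoungDiagram) :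
    {β // Step (false, k) α β ∧ Step (false, l) β γ} ≃
      {β // Step (false, l) α β ∧ Step (false, k) β γ} :=
  (transposeOrderIso.toEquiv.subtypeEquiv fun _ =>
      and_congr step_transpose.symm step_transpose.symm).trans <|
    (horizontalComm k l α.transpose γ.transpose).trans
      (transposeOrderIso.toEquiv.subtypeEquiv fun _ =>
        and_congr step_transpose.symm step_transpose.symm).symm

end HorizontalHorizontal

end YoungDiagram

/-! ### Commuting a horizontal and a vertical strip -/

/-- The number of `l`-element sets between `F` and `R` depends on the sizes of `F` and `R` only. -/
theorem Finset.card_filter_powerset_superset {R F : Finset ℕ} (hF : F ⊆ R) (l : ℕ) :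
    (R.powerset.filter fun U => F ⊆ U ∧ U.card = l).card =
      if F.card ≤ l then (R.card - F.card).choose (l - F.card) else 0 := by
  split_ifs with h
  · rw [← Finset.card_sdiff_of_subset hF, ← Finset.card_powersetCard]
    refine Finset.card_bij' (fun U _ => U \ F) (fun V _ => V ∪ F) ?_ ?_ ?_ ?_
    · intro U hU
      simp only [Finset.mem_filter, Finset.mem_powerset, Finset.mem_powersetCard] at hU ⊢
      exact ⟨Finset.sdiff_subset_sdiff hU.1 subset_rfl,
        by rw [Finset.card_sdiff_of_subset hU.2.1, hU.2.2]⟩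
    · intro V hV
      simp only [Finset.mem_filter, Finset.mem_powerset, Finset.mem_powersetCard] at hV ⊢
      refine ⟨Finset.union_subset (hV.1.trans Finset.sdiff_subset) hF, Finset.subset_union_right, ?_⟩
      rw [Finset.card_union_of_disjoint (Finset.disjoint_of_subset_left hV.1 Finset.sdiff_disjoint),
        hV.2]
      omega
    · intro U hU
      simp only [Finset.mem_filter] at hU
      exact Finset.sdiff_union_of_subset hU.2.1
    · intro V hV
      simp only [Finset.mem_powersetCard] at hV
      exact Finset.union_sdiff_cancel_right
        (Finset.disjoint_of_subset_left hV.1 Finset.sdiff_disjoint)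
  · rw [Finset.card_eq_zero, Finset.filter_eq_empty_iff]
    rintro U - ⟨h1, h2⟩
    exact h (h2 ▸ Finset.card_le_card h1)

namespace YoungDiagram

theorem card_add_card_of_rowLen {α β : YoungDiagram} {U : Finset ℕ}
    (h : ∀ i, α.rowLen i + (if i ∈ U then 1 else 0) = β.rowLen i) :
    α.card + U.card = β.card := by
  have hU : U ⊆ Finset.range (β.colLen 0) := by
    intro i hi
    have h1 := h i
    rw [if_pos hi] at h1
    rw [Finset.mem_range]
    by_contra h2
    have := rowLen_eq_zero (not_lt.1 h2)
    omega
  have hα : ∀ i, β.colLen 0 ≤ i → α.rowLen i = 0 := by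
    intro i hi
    have h1 := h i
    have h2 := rowLen_eq_zero hi
    omega
  rw [card_eq_sum_rowLen α hα, card_eq_sum_rowLen β fun _ => rowLen_eq_zero,
    ← Finset.sum_congr rfl fun i _ => h i, Finset.sum_add_distrib, Finset.sum_ite_mem,
    Finset.inter_eq_right.2 hU, Finset.sum_const, smul_eq_mul, mul_one]

section HorizontalVertical

variable (α γ : YoungDiagram)

/-- The rows in which `γ` exceeds `α`. -/
def longRows : Finset ℕ :=
  (Finset.range (γ.colLen 0)).filter fun i => α.rowLen i < γ.rowLen i

/-- The rows of `α` that are shorter by one than the following row of `γ`. -/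
def tightRows : Finset ℕ :=
  (Finset.range (γ.colLen 0)).filter fun i => γ.rowLen (i + 1) = α.rowLen i + 1

variable {α γ}

theorem mem_longRows {i : ℕ} : i ∈ longRows α γ ↔ α.rowLen i < γ.rowLen i := by
  simp only [longRows, Finset.mem_filter, Finset.mem_range, and_iff_right_iff_imp]
  intro h
  by_contra h1
  rw [rowLen_eq_zero (not_lt.1 h1)] at h
  exact Nat.not_lt_zero _ h

theorem mem_tightRows {i : ℕ} : i ∈ tightRows α γ ↔ γ.rowLen (i + 1) = α.rowLen i + 1 := by
  simp only [tightRows, Finset.mem_filter, Finset.mem_range, and_iff_right_iff_imp]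
  intro h
  by_contra h1
  rw [rowLen_eq_zero (i := i + 1) (by omega)] at h
  omega

theorem tightRows_subset : tightRows α γ ⊆ longRows α γ := by
  intro i hi
  rw [mem_tightRows] at hi
  rw [mem_longRows]
  have := γ.rowLen_anti i (i + 1) (Nat.le_succ i)
  omega

variable (α γ) in
/-- The rows of `γ` that are longer by one than the preceding row of `α`. -/
def tightSuccRows : Finset ℕ := (tightRows α γ).map ⟨Nat.succ, Nat.succ_injective⟩

theorem mem_tightSuccRows {i : ℕ} : i + 1 ∈ tightSuccRows α γ ↔
    γ.rowLen (i + 1) = α.rowLen i + 1 := by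
  simp [tightSuccRows, mem_tightRows]

theorem zero_notMem_tightSuccRows : 0 ∉ tightSuccRows α γ := by
  simp [tightSuccRows]

theorem tightSuccRows_subset : tightSuccRows α γ ⊆ longRows α γ := by
  rintro (_ | i) hi
  · exact absurd hi zero_notMem_tightSuccRows
  rw [mem_tightSuccRows] at hi
  rw [mem_longRows]
  have := α.rowLen_anti i (i + 1) (Nat.le_succ i)
  omega

variable (α γ) in
/-- The necessary conditions for `γ` to arise from `α` by a horizontal strip with `k` boxes and a
vertical strip with `l` boxes. -/
def MixedPair (k l : ℕ) : Prop :=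
  (∀ i, α.rowLen i ≤ γ.rowLen i) ∧ (∀ i, γ.rowLen (i + 1) ≤ α.rowLen i + 1) ∧
    γ.card = α.card + k + l

theorem mixedPair_of_horizontal_vertical {k l : ℕ} {β : YoungDiagram}
    (h : Step (true, k) α β ∧ Step (false, l) β γ) : MixedPair α γ k l := by
  obtain ⟨⟨⟨h1, h2⟩, h3⟩, ⟨h4, h5⟩, h6⟩ := h
  rw [le_iff_rowLen_le] at h1 h4
  refine ⟨fun i => (h1 i).trans (h4 i), fun i => ?_, ?_⟩
  · have := h2 i
    have := h5 (i + 1)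
    omega
  · dsimp only at h3 h6
    omega

theorem mixedPair_of_vertical_horizontal {k l : ℕ} {β : YoungDiagram}
    (h : Step (false, l) α β ∧ Step (true, k) β γ) : MixedPair α γ k l := by
  obtain ⟨⟨⟨h1, h2⟩, h3⟩, ⟨h4, h5⟩, h6⟩ := h
  rw [le_iff_rowLen_le] at h1 h4
  refine ⟨fun i => (h1 i).trans (h4 i), fun i => ?_, ?_⟩
  · have := h2 i
    have := h5 i
    omega
  · dsimp only at h3 h6
    omega

theorem longRows_spec {β : YoungDiagram} (h : Strip false α β) (i : ℕ) :
    α.rowLen i + (if i ∈ longRows α β then 1 else 0) = β.rowLen i := by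
  have h1 := le_iff_rowLen_le.1 h.1 i
  have h2 := h.2 i
  simp only [mem_longRows]
  split_ifs <;> omega

theorem longRows_eq_of_rowLen {β : YoungDiagram} {U : Finset ℕ}
    (h : ∀ i, α.rowLen i + (if i ∈ U then 1 else 0) = β.rowLen i) : longRows α β = U := by
  ext i
  have := h i
  rw [mem_longRows]
  split_ifs at this with hi <;> simp only [hi, iff_true, iff_false] <;> omega

/-- Diagrams reached from `α` by a horizontal strip and from which `γ` is reached by a vertical
strip correspond to the sets of rows that the vertical strip meets. -/
theorem nonempty_horizontal_vertical_equiv {k l : ℕ} (H : MixedPair α γ k l) :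
    Nonempty ({β // Step (true, k) α β ∧ Step (false, l) β γ} ≃
      (longRows α γ).powerset.filter fun U => tightSuccRows α γ ⊆ U ∧ U.card = l) := by
  obtain ⟨H1, H2, H3⟩ := H
  refine ⟨Equiv.ofBijective (fun β => ⟨longRows β.1 γ, ?_⟩) ⟨?_, ?_⟩⟩
  · obtain ⟨β, ⟨⟨h1, h2⟩, h3⟩, h4, h5⟩ := β
    rw [le_iff_rowLen_le] at h1
    have h6 := card_add_card_of_rowLen (longRows_spec h4)
    simp only [Finset.mem_filter, Finset.mem_powerset]
    refine ⟨fun i hi => ?_, ?_, by dsimp only at h5; omega⟩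
    · rw [mem_longRows] at hi ⊢
      exact (h1 i).trans_lt hi
    · rintro (_ | i) hi
      · exact absurd hi zero_notMem_tightSuccRows
      · rw [mem_tightSuccRows] at hi
        rw [mem_longRows, hi]
        exact Nat.lt_succ_of_le (h2 i)
  · intro β β' h
    have h : longRows β.1 γ = longRows β'.1 γ := congrArg Subtype.val h
    refine Subtype.ext (ext_rowLen fun i => ?_)
    have h1 := longRows_spec β.2.2.1 i
    have h2 := longRows_spec β'.2.2.1 i
    rw [h] at h1
    omega
  · rintro ⟨U, hU⟩
    simp only [Finset.mem_filter, Finset.mem_powerset] at hU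
    obtain ⟨hR, hF, hl⟩ := hU
    have hR' : ∀ i, i ∈ U → α.rowLen i < γ.rowLen i := fun i hi => mem_longRows.1 (hR hi)
    have hF' : ∀ i, i + 1 ∉ U → γ.rowLen (i + 1) ≤ α.rowLen i := by
      intro i hi
      by_contra h
      exact hi (hF (mem_tightSuccRows.2 (by have := H2 i; omega)))
    -- The critical case is `i ∈ U`, `i + 1 ∉ U`: there row `i + 1` of `γ` is at most row `i` of
    -- `α`, which is less than row `i` of `γ`.
    have hanti : Antitone fun i => γ.rowLen i - (if i ∈ U then 1 else 0) := by
      refine antitone_nat_of_succ_le fun i => ?_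
      have h1 := hR' i
      have h2 := hF' i
      have h3 := γ.rowLen_anti i (i + 1) (Nat.le_succ i)
      split_ifs with h4 h5 h5 <;> simp only [h4, h5, not_true_eq_false, not_false_eq_true,
        false_imp_iff, true_imp_iff] at h1 h2 <;> omega
    have hrow := rowLen_cut (γ := γ) hanti fun i => Nat.sub_le _ _
    generalize γ.cut _ hanti = β at hrow
    have hspec : ∀ i, β.rowLen i + (if i ∈ U then 1 else 0) = γ.rowLen i := by
      intro i
      have h1 := hR' i
      have h2 := hrow i
      split_ifs at h2 ⊢ with h4
      · have := h1 h4
        omega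
      · omega
    have hcard := card_add_card_of_rowLen hspec
    refine ⟨⟨β, ⟨⟨le_iff_rowLen_le.2 fun i => ?_, fun i => ?_⟩, by dsimp only; omega⟩,
      ⟨le_iff_rowLen_le.2 fun i => ?_, fun i => ?_⟩, by dsimp only; omega⟩,
      Subtype.ext (longRows_eq_of_rowLen hspec)⟩
    · have h1 := hspec i
      have h2 := hR' i
      have h3 := H1 i
      split_ifs at h1 with h4
      · have := h2 h4
        omega
      · omega
    · have h1 := hspec (i + 1)
      have h2 := hF' i
      have h3 := H2 i
      split_ifs at h1 with h4
      · omega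
      · have := h2 h4
        omega
    · have := hspec i
      omega
    · have := hspec i
      split_ifs at this <;> omega

/-- Diagrams reached from `α` by a vertical strip and from which `γ` is reached by a horizontal
strip correspond to the sets of rows that the vertical strip meets. -/
theorem nonempty_vertical_horizontal_equiv {k l : ℕ} (H : MixedPair α γ k l) :
    Nonempty ({β // Step (false, l) α β ∧ Step (true, k) β γ} ≃
      (longRows α γ).powerset.filter fun U => tightRows α γ ⊆ U ∧ U.card = l) := by
  obtain ⟨H1, H2, H3⟩ := H
  refine ⟨Equiv.ofBijective (fun β => ⟨longRows α β.1, ?_⟩) ⟨?_, ?_⟩⟩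
  · obtain ⟨β, ⟨h4, h5⟩, ⟨h1, h2⟩, h3⟩ := β
    rw [le_iff_rowLen_le] at h1
    have h6 := card_add_card_of_rowLen (longRows_spec h4)
    simp only [Finset.mem_filter, Finset.mem_powerset]
    refine ⟨fun i hi => ?_, fun i hi => ?_, by dsimp only at h5; omega⟩
    · rw [mem_longRows] at hi ⊢
      exact hi.trans_le (h1 i)
    · rw [mem_tightRows] at hi
      rw [mem_longRows]
      have := h2 i
      omega
  · intro β β' h
    have h : longRows α β.1 = longRows α β'.1 := congrArg Subtype.val h
    refine Subtype.ext (ext_rowLen fun i => ?_)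
    have h1 := longRows_spec β.2.1.1 i
    have h2 := longRows_spec β'.2.1.1 i
    rw [h] at h1
    omega
  · rintro ⟨U, hU⟩
    simp only [Finset.mem_filter, Finset.mem_powerset] at hU
    obtain ⟨hR, hF, hl⟩ := hU
    have hR' : ∀ i, i ∈ U → α.rowLen i < γ.rowLen i := fun i hi => mem_longRows.1 (hR hi)
    have hF' : ∀ i, i ∉ U → γ.rowLen (i + 1) ≤ α.rowLen i := by
      intro i hi
      by_contra h
      exact hi (hF (mem_tightRows.2 (by have := H2 i; omega)))
    -- The critical case is `i + 1 ∈ U`, `i ∉ U`: there row `i + 1` of `α` is less than row `i + 1`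
    -- of `γ`, which is at most row `i` of `α`.
    have hanti : Antitone fun i => α.rowLen i + (if i ∈ U then 1 else 0) := by
      refine antitone_nat_of_succ_le fun i => ?_
      have h1 := hR' (i + 1)
      have h2 := hF' i
      have h3 := α.rowLen_anti i (i + 1) (Nat.le_succ i)
      split_ifs with h4 h5 h5 <;> simp only [h4, h5, not_true_eq_false, not_false_eq_true,
        false_imp_iff, true_imp_iff] at h1 h2 <;> omega
    have hspec := rowLen_cut (γ := γ) hanti fun i => by
      have h1 := hR' i
      have h2 := H1 i
      split_ifs with h4
      · exact h1 h4
      · exact h2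
    generalize γ.cut _ hanti = β at hspec
    replace hspec := fun i => (hspec i).symm
    have hcard := card_add_card_of_rowLen hspec
    refine ⟨⟨β, ⟨⟨le_iff_rowLen_le.2 fun i => ?_, fun i => ?_⟩, by dsimp only; omega⟩,
      ⟨le_iff_rowLen_le.2 fun i => ?_, fun i => ?_⟩, by dsimp only; omega⟩,
      Subtype.ext (longRows_eq_of_rowLen hspec)⟩
    · have := hspec i
      omega
    · have := hspec i
      split_ifs at this <;> omega
    · have h1 := hspec i
      have h2 := hR' i
      have h3 := H1 i
      split_ifs at h1 with h4
      · have := h2 h4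
        omega
      · omega
    · have h1 := hspec i
      have h2 := hF' i
      have h3 := H2 i
      split_ifs at h1 with h4
      · omega
      · have := h2 h4
        omega

/-- Horizontal and vertical strips commute. -/
theorem nonempty_mixedComm (k l : ℕ) (α γ : YoungDiagram) :
    Nonempty ({β // Step (true, k) α β ∧ Step (false, l) β γ} ≃
      {β // Step (false, l) α β ∧ Step (true, k) β γ}) := by
  by_cases H : MixedPair α γ k l
  · obtain ⟨e⟩ := nonempty_horizontal_vertical_equiv H
    obtain ⟨e'⟩ := nonempty_vertical_horizontal_equiv H
    refine ⟨e.trans ((Finset.equivOfCardEq ?_).trans e'.symm)⟩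
    -- The rows forced into the vertical strip in the two orders differ by a shift by one, so they
    -- are equally many inside the same set `longRows α γ`.
    rw [Finset.card_filter_powerset_superset tightSuccRows_subset,
      Finset.card_filter_powerset_superset tightRows_subset, tightSuccRows, Finset.card_map]
  · have h1 : IsEmpty {β // Step (true, k) α β ∧ Step (false, l) β γ} :=
      ⟨fun β => H (mixedPair_of_horizontal_vertical β.2)⟩
    have h2 : IsEmpty {β // Step (false, l) α β ∧ Step (true, k) β γ} :=
      ⟨fun β => H (mixedPair_of_vertical_horizontal β.2)⟩
    exact ⟨Equiv.equivOfIsEmpty _ _⟩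

end HorizontalVertical

/-! ### Chains of strips and their rearrangement -/

theorem nonempty_stepComm (x y : Bool × ℕ) (α γ : YoungDiagram) :
    Nonempty ({β // Step x α β ∧ Step y β γ} ≃ {β // Step y α β ∧ Step x β γ}) := by
  obtain ⟨_ | _, k⟩ := x <;> obtain ⟨_ | _, l⟩ := y
  · exact ⟨verticalComm k l α γ⟩
  · exact (nonempty_mixedComm l k α γ).map Equiv.symm
  · exact nonempty_mixedComm k l α γ
  · exact ⟨horizontalComm k l α γ⟩

/-- Chains of diagrams from `α` to `γ` whose steps are, from the last to the first, those
listed. -/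
def Chain (α : YoungDiagram) : List (Bool × ℕ) → YoungDiagram → Type
  | [], γ => PLift (α = γ)
  | x :: l, γ => Σ β : {β // Step x β γ}, Chain α l β.1

/-- The last two steps of a chain, grouped around the diagram between them. -/
def chainConsConsEquiv (α : YoungDiagram) (x y : Bool × ℕ) (l : List (Bool × ℕ))
    (γ : YoungDiagram) :
    Chain α (x :: y :: l) γ ≃ Σ β', {β // Step y β' β ∧ Step x β γ} × Chain α l β' where
  toFun c := ⟨c.2.1.1, ⟨c.1.1, c.2.1.2, c.1.2⟩, c.2.2⟩
  invFun c := ⟨⟨c.2.1.1, c.2.1.2.2⟩, ⟨c.1, c.2.1.2.1⟩, c.2.2⟩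
  left_inv _ := rfl
  right_inv _ := rfl

/-- An adjacent transposition changes only the diagram between two strips, so grouping chains by the
diagram below both reduces it to `nonempty_stepComm`. Quantifying over `γ` lets the induction pass
below the last strip. -/
theorem nonempty_chain_equiv_of_perm (α : YoungDiagram) {l l' : List (Bool × ℕ)}
    (h : l.Perm l') : ∀ γ, Nonempty (Chain α l γ ≃ Chain α l' γ) := by
  induction h with
  | nil => exact fun γ => ⟨Equiv.refl _⟩
  | cons x _ ih => exact fun γ => ⟨Equiv.sigmaCongrRight fun β => (ih β.1).some⟩
  | swap x y l =>
    exact fun γ => ⟨(chainConsConsEquiv α y x l γ).trans <|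
      (Equiv.sigmaCongrRight fun β' =>
        Equiv.prodCongr (nonempty_stepComm x y β' γ).some (Equiv.refl _)).trans
      (chainConsConsEquiv α x y l γ).symm⟩
  | trans _ _ ih ih' => exact fun γ => ⟨(ih γ).some.trans (ih' γ).some⟩

/-! ### Chains ending at the staircase -/

theorem rowLen_staircase (n i : ℕ) : (staircase n).rowLen i = n - i := by
  have key : ∀ j, j < (staircase n).rowLen i ↔ j < n - i := by
    intro j
    rw [← mem_iff_lt_rowLen, ← mem_cells]
    simp only [staircase, Finset.mem_filter, Finset.mem_product, Finset.mem_range]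
    omega
  exact le_antisymm (le_of_forall_lt fun j hj => (key j).1 hj)
    (le_of_forall_lt fun j hj => (key j).2 hj)

/-- A strip removed from the staircase is a set of corners, so it is horizontal and vertical. -/
theorem strip_staircase (b b' : Bool) {n : ℕ} {β : YoungDiagram}
    (h : Strip b β (staircase n)) : Strip b' β (staircase n) := by
  -- Consecutive nonzero rows of the staircase, and the last one and zero, differ by exactly one, so
  -- both strip conditions reduce to this inequality.
  refine (?_ : β ≤ staircase n ∧ ∀ i, n - i ≤ β.rowLen i + 1).elim fun h1 h2 => ?_
  · refine ⟨h.le, fun i => ?_⟩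
    cases b
    · simpa only [rowLen_staircase] using h.2 i
    · have := h.2 i
      rw [rowLen_staircase] at this
      omega
  · cases b'
    · exact ⟨h1, fun i => by rw [rowLen_staircase]; exact h2 i⟩
    · refine ⟨h1, fun i => ?_⟩
      have := h2 i
      rw [rowLen_staircase]
      omega

theorem step_staircase_iff (b b' : Bool) {n k : ℕ} {β : YoungDiagram} :
    Step (b, k) β (staircase n) ↔ Step (b', k) β (staircase n) :=
  and_congr_left fun _ => ⟨strip_staircase b b', strip_staircase b' b⟩

/-- The last strip of a chain ending at the staircase can be horizontal or vertical. -/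
def chainStaircaseCons (α : YoungDiagram) (b b' : Bool) (k : ℕ) (l : List (Bool × ℕ)) (n : ℕ) :
    Chain α ((b, k) :: l) (staircase n) ≃ Chain α ((b', k) :: l) (staircase n) where
  toFun c := ⟨⟨c.1.1, (step_staircase_iff b b').1 c.1.2⟩, c.2⟩
  invFun c := ⟨⟨c.1.1, (step_staircase_iff b b').2 c.1.2⟩, c.2⟩
  left_inv _ := rfl
  right_inv _ := rfl

/-- The first strip of `l₂` is moved to the head of the list, where it ends at the staircase and may
be declared horizontal. It then joins the arbitrary prefix `l₁` while the induction treats the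
remaining strips, and finally returns to its place. -/
theorem nonempty_chain_staircase_append (α : YoungDiagram) (n : ℕ) (l₂ : List (Bool × ℕ)) :
    ∀ l₁, Nonempty (Chain α (l₁ ++ l₂) (staircase n) ≃
      Chain α (l₁ ++ l₂.map fun x => (true, x.2)) (staircase n)) := by
  induction l₂ with
  | nil => exact fun l₁ => ⟨Equiv.refl _⟩
  | cons x l₂ ih =>
    intro l₁
    obtain ⟨b, k⟩ := x
    have e₁ := nonempty_chain_equiv_of_perm α
      (List.perm_middle (a := (b, k)) (l₁ := l₁) (l₂ := l₂)) (staircase n)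
    have e₂ := chainStaircaseCons α b true k (l₁ ++ l₂) n
    have e₃ := ih ((true, k) :: l₁)
    have e₄ := nonempty_chain_equiv_of_perm α (List.perm_middle (a := (true, k)) (l₁ := l₁)
      (l₂ := l₂.map fun x => (true, x.2))).symm (staircase n)
    exact ⟨e₁.some.trans (e₂.trans (e₃.some.trans e₄.some))⟩

/-- The number of chains ending at the staircase does not depend on the kinds of the strips. -/
theorem nonempty_chain_staircase (α : YoungDiagram) (n : ℕ) {l l' : List (Bool × ℕ)}
    (h : l.map Prod.snd = l'.map Prod.snd) :
    Nonempty (Chain α l (staircase n) ≃ Chain α l' (staircase n)) := by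
  have key : (l.map fun x => (true, x.2)) = l'.map fun x => (true, x.2) := by
    have := congrArg (List.map fun k => (true, k)) h
    rw [List.map_map, List.map_map] at this
    exact this
  have e := (nonempty_chain_staircase_append α n l []).some
  have e' := (nonempty_chain_staircase_append α n l' []).some
  simp only [List.nil_append] at e e'
  rw [key] at e
  exact ⟨e.trans e'.symm⟩

end YoungDiagram

/-! ### Removing and adding the largest entry of a tableau -/

namespace GST

open YoungDiagram

variable {lam nu mu : YoungDiagram} {I : Set ℕ+}

theorem entry_mono (T : GST lam mu I) {b c : SkewCell lam mu} (h : b.1 ≤ c.1) :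
    T.entry b ≤ T.entry c := by
  obtain ⟨⟨i, j⟩, hb⟩ := b
  obtain ⟨⟨i', j'⟩, hc⟩ := c
  have hi : i ≤ i' := h.1
  have hj : j ≤ j' := h.2
  -- In a skew shape the corner `(i, j')` between two comparable boxes is again a box, so one row
  -- step and one column step suffice.
  have hd : (i, j') ∈ lam.cells \ mu.cells := by
    rw [Finset.mem_sdiff, mem_cells, mem_cells] at hb hc ⊢
    exact ⟨lam.up_left_mem hi le_rfl hc.1, fun h => hb.2 (mu.up_left_mem le_rfl hj h)⟩
  exact (T.row_weak ⟨_, hb⟩ ⟨_, hd⟩ rfl hj).trans (T.col_weak ⟨_, hd⟩ ⟨_, hc⟩ rfl hi)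

theorem wt_eq_card (T : GST lam mu I) (i : ℕ+) (s : Finset (ℕ × ℕ))
    (hs : ∀ c, c ∈ s ↔ ∃ h, T.entry ⟨c, h⟩ = i) : T.wt i = s.card := by
  rw [wt, ← Finset.card_map (Function.Embedding.subtype _)]
  congr 1
  ext c
  simp [hs]

/-- `T` arises from `S` by putting `m + 1` into all new boxes. -/
def Extends (m : ℕ) (T : GST lam mu I) (S : GST nu mu I) : Prop :=
  (∀ c h h', T.entry ⟨c, h⟩ = S.entry ⟨c, h'⟩) ∧ ∀ c h, c ∉ nu → T.entry ⟨c, h⟩ = m.succPNat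

theorem Extends.wt_eq {m : ℕ} {T : GST lam mu I} {S : GST nu mu I} (h : Extends m T S)
    (hnu : nu ≤ lam) {i : ℕ+} (hi : (i : ℕ) ≤ m) : T.wt i = S.wt i := by
  have hsimp : ∀ c, c ∈ (Finset.univ.filter fun b => S.entry b = i).map
      (Function.Embedding.subtype _) ↔ ∃ h, S.entry ⟨c, h⟩ = i := fun c => by simp
  rw [wt_eq_card S i _ hsimp]
  refine wt_eq_card T i _ fun c => ?_
  rw [hsimp]
  constructor
  · rintro ⟨hc, rfl⟩
    have hc' := Finset.mem_sdiff.1 hc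
    exact ⟨Finset.mem_sdiff.2 ⟨hnu hc'.1, hc'.2⟩, h.1 c _ _⟩
  · rintro ⟨hc, rfl⟩
    have hcnu : c ∈ nu := by
      by_contra hcnu
      rw [h.2 c hc hcnu, Nat.succPNat_coe] at hi
      omega
    exact ⟨Finset.mem_sdiff.2 ⟨hcnu, (Finset.mem_sdiff.1 hc).2⟩, (h.1 c _ _).symm⟩

theorem Extends.card_eq {m : ℕ} {T : GST lam mu I} {S : GST nu mu I} (h : Extends m T S)
    (hmu : mu ≤ nu) (hnu : nu ≤ lam) (hS : ∀ b, (S.entry b : ℕ) ≤ m) :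
    lam.card = nu.card + T.wt m.succPNat := by
  have hwt : T.wt m.succPNat = (lam.cells \ nu.cells).card := by
    refine wt_eq_card T _ _ fun c => ?_
    rw [Finset.mem_sdiff]
    constructor
    · rintro ⟨h1, h2⟩
      exact ⟨Finset.mem_sdiff.2 ⟨h1, fun h3 => h2 (hmu h3)⟩, h.2 c _ h2⟩
    · rintro ⟨hc, hcm⟩
      refine ⟨(Finset.mem_sdiff.1 hc).1, fun hcnu => ?_⟩
      have hc' : c ∈ nu.cells \ mu.cells := Finset.mem_sdiff.2 ⟨hcnu, (Finset.mem_sdiff.1 hc).2⟩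
      have := hS ⟨c, hc'⟩
      rw [← h.1 c hc hc', hcm, Nat.succPNat_coe] at this
      omega
  rw [hwt, Finset.card_sdiff_of_subset hnu]
  have := Finset.card_le_card hnu
  simp only [YoungDiagram.card]
  omega

/-- The diagram formed by `mu` and the boxes of `T` with entries at most `m`. -/
def lowerShape (T : GST lam mu I) (m : ℕ) : YoungDiagram where
  -- Here `h` is a proof that `c` is a box of the skew shape, so the condition is vacuous on `mu`.
  cells := lam.cells.filter fun c => ∀ h, (T.entry ⟨c, h⟩ : ℕ) ≤ m
  isLowerSet := by
    intro c d hdc hc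
    simp only [Finset.coe_filter, Set.mem_ofPred_eq] at hc ⊢
    refine ⟨lam.isLowerSet hdc hc.1, fun hd => ?_⟩
    have hc' : c ∈ lam.cells \ mu.cells :=
      Finset.mem_sdiff.2 ⟨hc.1, fun h => (Finset.mem_sdiff.1 hd).2 (mu.isLowerSet hdc h)⟩
    exact (PNat.coe_le_coe _ _ |>.2 (T.entry_mono (b := ⟨d, hd⟩) (c := ⟨c, hc'⟩) hdc)).trans
      (hc.2 hc')

theorem mem_lowerShape {T : GST lam mu I} {m : ℕ} {c : ℕ × ℕ} :
    c ∈ T.lowerShape m ↔ c ∈ lam ∧ ∀ h, (T.entry ⟨c, h⟩ : ℕ) ≤ m := by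
  rw [← mem_cells, lowerShape, Finset.mem_filter, mem_cells]

theorem lowerShape_le (T : GST lam mu I) (m : ℕ) : T.lowerShape m ≤ lam :=
  fun _ hc => (mem_lowerShape.1 hc).1

theorem le_lowerShape (T : GST lam mu I) (m : ℕ) (h : mu ≤ lam) : mu ≤ T.lowerShape m :=
  fun _ hc => mem_lowerShape.2 ⟨h hc, fun h' => absurd hc (Finset.mem_sdiff.1 h').2⟩

/-- The restriction of a tableau to a smaller diagram. -/
def restrict (T : GST lam mu I) (h : nu ≤ lam) : GST nu mu I where
  entry b := T.entry ⟨b.1, Finset.sdiff_subset_sdiff h subset_rfl b.2⟩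
  row_weak _ _ h1 h2 := T.row_weak _ _ h1 h2
  col_weak _ _ h1 h2 := T.col_weak _ _ h1 h2
  row_once i hi b c h1 h2 h3 := by
    have := T.row_once i hi _ _ h1 h2 h3
    exact Subtype.ext (congrArg (fun b => b.1) this)
  col_once i hi b c h1 h2 h3 := by
    have := T.col_once i hi _ _ h1 h2 h3
    exact Subtype.ext (congrArg (fun b => b.1) this)

theorem entry_eq_of_notMem_lowerShape {T : GST lam mu I} {m : ℕ}
    (hT : ∀ b, (T.entry b : ℕ) ≤ m + 1) {c : ℕ × ℕ} (h : c ∈ lam.cells \ mu.cells)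
    (hc : c ∉ T.lowerShape m) : T.entry ⟨c, h⟩ = m.succPNat := by
  have h1 := hT ⟨c, h⟩
  have h2 : ¬ (T.entry ⟨c, h⟩ : ℕ) ≤ m := fun h' =>
    hc (mem_lowerShape.2 ⟨(Finset.mem_sdiff.1 h).1, fun _ => h'⟩)
  exact PNat.eq (by rw [Nat.succPNat_coe]; omega)

theorem extends_restrict {T : GST lam mu I} {m : ℕ} (hT : ∀ b, (T.entry b : ℕ) ≤ m + 1) :
    Extends m T (T.restrict (T.lowerShape_le m)) :=
  ⟨fun _ _ _ => rfl, fun _ h hc => entry_eq_of_notMem_lowerShape hT h hc⟩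

open Classical in
/-- The kind of strip formed by the boxes with entry `i`. -/
noncomputable def kind (I : Set ℕ+) (i : ℕ+) : Bool := decide (i ∉ I)

theorem strip_kind_iff {i : ℕ+} (hnu : nu ≤ lam) : Strip (kind I i) nu lam ↔
    (i ∈ I → ∀ r j j', j < j' → (r, j) ∉ nu → (r, j') ∉ lam) ∧
      (i ∉ I → ∀ r r' j, r < r' → (r, j) ∉ nu → (r', j) ∉ lam) := by
  by_cases hi : i ∈ I
  · simp [kind, hi, strip_false_iff, hnu]
  · simp [kind, hi, strip_true_iff, hnu]

theorem strip_lowerShape {T : GST lam mu I} {m : ℕ} (hmu : mu ≤ lam)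
    (hT : ∀ b, (T.entry b : ℕ) ≤ m + 1) :
    Strip (kind I m.succPNat) (T.lowerShape m) lam := by
  have hcell : ∀ {c}, c ∈ lam → c ∉ T.lowerShape m → c ∈ lam.cells \ mu.cells := fun h1 h2 =>
    Finset.mem_sdiff.2 ⟨h1, fun h3 => h2 (T.le_lowerShape m hmu h3)⟩
  rw [strip_kind_iff (T.lowerShape_le m)]
  constructor
  · intro hi r j j' hj h1 h2
    have h3 : (r, j) ∈ lam := lam.up_left_mem le_rfl hj.le h2
    have h4 : (r, j') ∉ T.lowerShape m := fun h => h1 (up_left_mem _ le_rfl hj.le h)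
    have := T.row_once _ hi ⟨_, hcell h3 h1⟩ ⟨_, hcell h2 h4⟩ rfl
      (entry_eq_of_notMem_lowerShape hT _ h1) (entry_eq_of_notMem_lowerShape hT _ h4)
    simp only [Subtype.mk.injEq, Prod.mk.injEq, true_and] at this
    omega
  · intro hi r r' j hr h1 h2
    have h3 : (r, j) ∈ lam := lam.up_left_mem hr.le le_rfl h2
    have h4 : (r', j) ∉ T.lowerShape m := fun h => h1 (up_left_mem _ hr.le le_rfl h)
    have := T.col_once _ hi ⟨_, hcell h3 h1⟩ ⟨_, hcell h2 h4⟩ rfl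
      (entry_eq_of_notMem_lowerShape hT _ h1) (entry_eq_of_notMem_lowerShape hT _ h4)
    simp only [Subtype.mk.injEq, Prod.mk.injEq, and_true] at this
    omega

open Classical in
/-- The entries of the extension of `S` by boxes with entry `m + 1`. -/
noncomputable def extendEntry (m : ℕ) (S : GST nu mu I) (c : SkewCell lam mu) : ℕ+ :=
  if h : c.1 ∈ nu then S.entry ⟨c.1, Finset.mem_sdiff.2 ⟨h, (Finset.mem_sdiff.1 c.2).2⟩⟩
  else m.succPNat

theorem extendEntry_of_mem (m : ℕ) (S : GST nu mu I) {c : SkewCell lam mu} (h : c.1 ∈ nu) :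
    extendEntry m S c = S.entry ⟨c.1, Finset.mem_sdiff.2 ⟨h, (Finset.mem_sdiff.1 c.2).2⟩⟩ :=
  dif_pos h

theorem extendEntry_of_notMem (m : ℕ) (S : GST nu mu I) {c : SkewCell lam mu} (h : c.1 ∉ nu) :
    extendEntry m S c = m.succPNat :=
  dif_neg h

theorem extendEntry_mono {m : ℕ} {S : GST nu mu I} (hS : ∀ b, (S.entry b : ℕ) ≤ m)
    {b c : SkewCell lam mu} (h : b.1 ≤ c.1) : extendEntry m S b ≤ extendEntry m S c := by
  by_cases hc : c.1 ∈ nu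
  · have hb : b.1 ∈ nu := nu.isLowerSet h hc
    rw [extendEntry_of_mem m S hb, extendEntry_of_mem m S hc]
    exact S.entry_mono h
  · rw [extendEntry_of_notMem m S hc]
    by_cases hb : b.1 ∈ nu
    · rw [extendEntry_of_mem m S hb, ← PNat.coe_le_coe, Nat.succPNat_coe]
      exact (hS _).trans (Nat.le_succ m)
    · rw [extendEntry_of_notMem m S hb]

theorem extendEntry_eq_succ_iff {m : ℕ} {S : GST nu mu I} (hS : ∀ b, (S.entry b : ℕ) ≤ m)
    {c : SkewCell lam mu} : extendEntry m S c = m.succPNat ↔ c.1 ∉ nu := by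
  refine ⟨fun h hc => ?_, extendEntry_of_notMem m S⟩
  rw [extendEntry_of_mem m S hc] at h
  have := hS ⟨c.1, Finset.mem_sdiff.2 ⟨hc, (Finset.mem_sdiff.1 c.2).2⟩⟩
  rw [h, Nat.succPNat_coe] at this
  omega

/-- The extension of `S` by a strip of boxes with entry `m + 1`. -/
noncomputable def extend (m : ℕ) (S : GST nu mu I) (hS : ∀ b, (S.entry b : ℕ) ≤ m)
    (h : Strip (kind I m.succPNat) nu lam) : GST lam mu I where
  entry := extendEntry m S
  row_weak b c h1 h2 := extendEntry_mono hS ⟨h1.le, h2⟩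
  col_weak b c h1 h2 := extendEntry_mono hS ⟨h2, h1.le⟩
  row_once i hi b c h1 h2 h3 := by
    rw [strip_kind_iff h.le] at h
    by_cases him : i = m.succPNat
    · subst him
      rw [extendEntry_eq_succ_iff hS] at h2 h3
      obtain ⟨⟨r, j⟩, hb⟩ := b
      obtain ⟨⟨r', j'⟩, hc⟩ := c
      obtain rfl : r = r' := h1
      rcases lt_trichotomy j j' with hj | rfl | hj
      · exact absurd (Finset.mem_sdiff.1 hc).1 (h.1 hi r j j' hj h2)
      · rfl
      · exact absurd (Finset.mem_sdiff.1 hb).1 (h.1 hi r j' j hj h3)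
    · have hb : b.1 ∈ nu := by
        by_contra hb
        exact him (h2.symm.trans (extendEntry_of_notMem m S hb))
      have hc : c.1 ∈ nu := by
        by_contra hc
        exact him (h3.symm.trans (extendEntry_of_notMem m S hc))
      rw [extendEntry_of_mem m S hb] at h2
      rw [extendEntry_of_mem m S hc] at h3
      have := S.row_once i hi _ _ h1 h2 h3
      exact Subtype.ext (congrArg (fun b => b.1) this)
  col_once i hi b c h1 h2 h3 := by
    rw [strip_kind_iff h.le] at h
    by_cases him : i = m.succPNat
    · subst him
      rw [extendEntry_eq_succ_iff hS] at h2 h3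
      obtain ⟨⟨r, j⟩, hb⟩ := b
      obtain ⟨⟨r', j'⟩, hc⟩ := c
      obtain rfl : j = j' := h1
      rcases lt_trichotomy r r' with hr | rfl | hr
      · exact absurd (Finset.mem_sdiff.1 hc).1 (h.2 hi r r' j hr h2)
      · rfl
      · exact absurd (Finset.mem_sdiff.1 hb).1 (h.2 hi r' r j hr h3)
    · have hb : b.1 ∈ nu := by
        by_contra hb
        exact him (h2.symm.trans (extendEntry_of_notMem m S hb))
      have hc : c.1 ∈ nu := by
        by_contra hc
        exact him (h3.symm.trans (extendEntry_of_notMem m S hc))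
      rw [extendEntry_of_mem m S hb] at h2
      rw [extendEntry_of_mem m S hc] at h3
      have := S.col_once i hi _ _ h1 h2 h3
      exact Subtype.ext (congrArg (fun b => b.1) this)

theorem extends_extend {m : ℕ} {S : GST nu mu I} (hS : ∀ b, (S.entry b : ℕ) ≤ m)
    (h : Strip (kind I m.succPNat) nu lam) : Extends m (extend m S hS h) S :=
  ⟨fun c _ h' => extendEntry_of_mem (c := ⟨c, _⟩) m S (Finset.mem_sdiff.1 h').1,
    fun c _ hc => extendEntry_of_notMem (c := ⟨c, _⟩) m S hc⟩

/-- Tableaux with entries at most `m` and prescribed weight. -/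
def Bounded (mu : YoungDiagram) (I : Set ℕ+) (w : ℕ+ → ℕ) (m : ℕ) (lam : YoungDiagram) : Type :=
  {T : GST lam mu I // mu ≤ lam ∧ (∀ b, (T.entry b : ℕ) ≤ m) ∧
    ∀ i : ℕ+, (i : ℕ) ≤ m → T.wt i = w i}

/-- Comparing entries at the underlying cells avoids transporting a tableau along an equality of
shapes. -/
theorem sigma_bounded_ext {w : ℕ+ → ℕ} {m : ℕ} {p : YoungDiagram → Prop}
    {x y : Σ ν : {ν // p ν}, Bounded mu I w m ν.1} (h : x.1.1 = y.1.1)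
    (h' : ∀ c hx hy, x.2.1.entry ⟨c, hx⟩ = y.2.1.entry ⟨c, hy⟩) : x = y := by
  obtain ⟨⟨ν, hν⟩, T, hT⟩ := x
  obtain ⟨⟨ν', hν'⟩, T', hT'⟩ := y
  obtain rfl : ν = ν' := h
  obtain rfl : T = T' := GST.ext (funext fun b => h' b.1 b.2 b.2)
  rfl

/-- Tableaux with entries at most `m + 1` are tableaux with entries at most `m`, extended by a
strip. -/
noncomputable def boundedSuccEquiv (mu : YoungDiagram) (I : Set ℕ+) (w : ℕ+ → ℕ) (m : ℕ)
    (lam : YoungDiagram) : Bounded mu I w (m + 1) lam ≃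
      Σ ν : {ν // Step (kind I m.succPNat, w m.succPNat) ν lam}, Bounded mu I w m ν.1 where
  toFun T :=
    have hS : ∀ b, ((T.1.restrict (T.1.lowerShape_le m)).entry b : ℕ) ≤ m := fun b =>
      (mem_lowerShape.1 (Finset.mem_sdiff.1 b.2).1).2 _
    have hext := extends_restrict T.2.2.1
    have hmu := T.1.le_lowerShape m T.2.1
    ⟨⟨T.1.lowerShape m, strip_lowerShape T.2.1 T.2.2.1,
      (hext.card_eq hmu (T.1.lowerShape_le m) hS).trans
        (by rw [T.2.2.2 _ (Nat.succPNat_coe m).le])⟩,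
      ⟨T.1.restrict (T.1.lowerShape_le m), hmu, hS, fun i hi =>
        (hext.wt_eq (T.1.lowerShape_le m) hi).symm.trans (T.2.2.2 i (hi.trans (Nat.le_succ m)))⟩⟩
  invFun x :=
    have hext := extends_extend x.2.2.2.1 x.1.2.1
    ⟨extend m x.2.1 x.2.2.2.1 x.1.2.1, x.2.2.1.trans x.1.2.1.le, fun b => by
      by_cases hb : b.1 ∈ x.1.1
      · rw [hext.1 b.1 b.2 (Finset.mem_sdiff.2 ⟨hb, (Finset.mem_sdiff.1 b.2).2⟩)]
        exact (x.2.2.2.1 _).trans (Nat.le_succ m)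
      · rw [hext.2 b.1 b.2 hb, Nat.succPNat_coe], fun i hi => by
      rcases Nat.lt_or_ge m i with h | h
      · obtain rfl : i = m.succPNat := PNat.eq (by rw [Nat.succPNat_coe]; omega)
        -- The number of entries `m + 1` is the difference of the two diagram sizes, which `Step`
        -- prescribes.
        have h1 := hext.card_eq x.2.2.1 x.1.2.1.le x.2.2.2.1
        have h2 := x.1.2.2
        dsimp only at h2
        omega
      · exact (hext.wt_eq x.1.2.1.le h).trans (x.2.2.2.2 i h)⟩
  left_inv T := by
    refine Subtype.ext (GST.ext (funext fun b => ?_))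
    by_cases hb : b.1 ∈ T.1.lowerShape m
    · exact extendEntry_of_mem _ _ hb
    · exact (extendEntry_of_notMem _ _ hb).trans
        (entry_eq_of_notMem_lowerShape T.2.2.1 b.2 hb).symm
  right_inv x := by
    have hext := extends_extend x.2.2.2.1 x.1.2.1
    refine sigma_bounded_ext ?_ fun c hx hy => hext.1 c _ hy
    refine SetLike.ext fun c => ?_
    refine mem_lowerShape.trans ⟨fun h => ?_, fun h => ⟨x.1.2.1.le h, fun h' => ?_⟩⟩
    · by_contra hc
      have hc' : c ∈ lam.cells \ mu.cells := Finset.mem_sdiff.2 ⟨h.1, fun h' => hc (x.2.2.1 h')⟩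
      have := h.2 hc'
      rw [hext.2 c hc' hc, Nat.succPNat_coe] at this
      omega
    · rw [hext.1 c h' (Finset.mem_sdiff.2 ⟨h, (Finset.mem_sdiff.1 h').2⟩)]
      exact x.2.2.2.1 _

/-! ### From tableaux to chains, and gluing the weight fibres -/

/-- The strips of a tableau with entries at most `m`, the one with the largest entry first. -/
noncomputable def strips (I : Set ℕ+) (w : ℕ+ → ℕ) : ℕ → List (Bool × ℕ)
  | 0 => []
  | m + 1 => (kind I m.succPNat, w m.succPNat) :: strips I w m

theorem map_snd_strips (I I' : Set ℕ+) (w : ℕ+ → ℕ) (m : ℕ) :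
    (strips I w m).map Prod.snd = (strips I' w m).map Prod.snd := by
  induction m with
  | zero => rfl
  | succ m ih => simp only [strips, List.map_cons, ih]

theorem nonempty_bounded_equiv_chain (mu : YoungDiagram) (I : Set ℕ+) (w : ℕ+ → ℕ) (m : ℕ) :
    ∀ lam, Nonempty (Bounded mu I w m lam ≃ Chain mu (strips I w m) lam) := by
  induction m with
  | zero =>
    intro lam
    -- Entries are positive, so the bound `0` leaves no boxes; both sides then say only that `mu =
    -- lam`.
    have hpos : ∀ T : Bounded mu I w 0 lam, IsEmpty (SkewCell lam mu) := fun T =>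
      ⟨fun b => absurd (T.2.2.1 b) (by have := (T.1.entry b).pos; omega)⟩
    refine ⟨⟨fun T => ⟨?_⟩, fun h => ⟨?_, ?_⟩, fun T => ?_, fun h => ?_⟩⟩
    · refine le_antisymm T.2.1 fun c hc => ?_
      by_contra hc'
      exact (hpos T).false ⟨c, Finset.mem_sdiff.2 ⟨hc, hc'⟩⟩
    · have hE : SkewCell lam mu → False := fun b => by
        obtain ⟨rfl⟩ := h
        exact (Finset.mem_sdiff.1 b.2).2 (Finset.mem_sdiff.1 b.2).1
      exact ⟨fun b => (hE b).elim, fun b => (hE b).elim, fun b => (hE b).elim,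
        fun _ _ b => (hE b).elim, fun _ _ b => (hE b).elim⟩
    · refine ⟨h.down.le, fun b => ?_, fun i hi => absurd hi (by have := i.pos; omega)⟩
      obtain ⟨rfl⟩ := h
      exact absurd (Finset.mem_sdiff.1 b.2).1 (Finset.mem_sdiff.1 b.2).2
    · exact Subtype.ext (GST.ext (funext fun b => ((hpos T).false b).elim))
    · exact Subsingleton.elim (α := PLift (mu = lam)) _ _
  | succ m ih =>
    exact fun lam => ⟨(boundedSuccEquiv mu I w m lam).trans
      (Equiv.sigmaCongrRight fun ν => (ih ν.1).some)⟩

theorem wt_pos (T : GST lam mu I) (b : SkewCell lam mu) : 0 < T.wt (T.entry b) :=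
  Finset.card_pos.2 ⟨b, by simp⟩

theorem exists_wt_eq_zero (T : GST lam mu I) : ∃ m : ℕ, ∀ i : ℕ+, m < i → T.wt i = 0 := by
  obtain ⟨m, hm⟩ := (Set.finite_range fun b => (T.entry b : ℕ)).bddAbove
  refine ⟨m, fun i hi => Finset.card_eq_zero.2 (Finset.filter_eq_empty_iff.2 ?_)⟩
  rintro b - rfl
  exact absurd (hm (Set.mem_range_self b)) (not_le.2 hi)

/-- Tableaux of weight `w` have bounded entries if `w` has finite support. -/
def wtFiberEquiv {w : ℕ+ → ℕ} {m : ℕ} (hmu : mu ≤ lam) (hw : ∀ i : ℕ+, m < i → w i = 0) :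
    {T : GST lam mu I // T.wt = w} ≃ Bounded mu I w m lam :=
  Equiv.subtypeEquivRight fun T => by
    constructor
    · rintro rfl
      refine ⟨hmu, fun b => ?_, fun _ _ => rfl⟩
      by_contra hb
      exact (T.wt_pos b).ne' (hw _ (not_le.1 hb))
    · rintro ⟨-, h1, h2⟩
      funext i
      rcases Nat.lt_or_ge m i with h | h
      · rw [hw i h]
        refine Finset.card_eq_zero.2 (Finset.filter_eq_empty_iff.2 ?_)
        rintro b - rfl
        exact absurd (h1 b) (not_le.2 h)
      · exact h2 i h

theorem nonempty_wtFiber_equiv {n : ℕ} (hmu : mu ≤ staircase n) (I I' : Set ℕ+) (w : ℕ+ → ℕ) :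
    Nonempty ({T : GST (staircase n) mu I // T.wt = w} ≃
      {T : GST (staircase n) mu I' // T.wt = w}) := by
  by_cases hw : ∃ m : ℕ, ∀ i : ℕ+, m < i → w i = 0
  · obtain ⟨m, hw⟩ := hw
    obtain ⟨e⟩ := nonempty_bounded_equiv_chain mu I w m (staircase n)
    obtain ⟨e'⟩ := nonempty_bounded_equiv_chain mu I' w m (staircase n)
    obtain ⟨f⟩ := nonempty_chain_staircase mu n (map_snd_strips I I' w m)
    exact ⟨(wtFiberEquiv hmu hw).trans <| e.trans <| f.trans <| e'.symm.trans
      (wtFiberEquiv hmu hw).symm⟩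
  -- A tableau has finitely many boxes, so a weight of infinite support is attained for no set.
  · have h : ∀ J : Set ℕ+, IsEmpty {T : GST (staircase n) mu J // T.wt = w} := fun J =>
      ⟨fun T => hw (T.2 ▸ T.1.exists_wt_eq_zero)⟩
    have := h I
    have := h I'
    exact ⟨Equiv.equivOfIsEmpty _ _⟩

end GST

theorem mainTheorem2 (n : ℕ) (mu : YoungDiagram) (hmu : mu ≤ staircase n) (I I' : Set ℕ+) :
    ∃ phi : GST (staircase n) mu I ≃ GST (staircase n) mu I',
      ∀ T : GST (staircase n) mu I, (phi T).wt = T.wt := by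
  let e : ∀ w : ℕ+ → ℕ, {T : GST (staircase n) mu I // T.wt = w} ≃
      {T : GST (staircase n) mu I' // T.wt = w} := fun w =>
    (GST.nonempty_wtFiber_equiv hmu I I' w).some
  exact ⟨(Equiv.sigmaFiberEquiv GST.wt).symm.trans <|
    (Equiv.sigmaCongrRight e).trans (Equiv.sigmaFiberEquiv GST.wt), fun T => (e T.wt ⟨T, rfl⟩).2⟩
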